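/- Let $\mathbb{D}=\{z\in\mathbb{C}:|z|<1\}$. For functions $f,g$ analytic on $\mathbb{D}$ write $f\prec g$ ($f$ is subordinate to $g$) if $f=g\circ w$ on $\mathbb{D}$ for some analytic $w:\mathbb{D}\to\mathbb{D}$ with $w(0)=0$. Square roots of complex numbers are principal and $\log$ is the natural logarithm. Let $$\varphi_0(z)=1+\frac{z}{k}\cdot\frac{k+z}{k-z}\quad(k=\sqrt2+1),\qquad \varphi_{\sin}(z)=1+\sin z,\qquad \varphi_{\rm lune}(z)=z+\sqrt{1+z^2}.$$ For real $\beta$ call a function $p$ analytic on $\mathbb{D}$ *$\beta$-admissible* if $p(0)=1$ and $$1+\beta\,\frac{zp'(z)}{p^2(z)}\prec\sqrt{1+z}.$$ Say that $b>0$ is the *sharp bound* for a function $\mathcal P$ if, for every real $\beta\ge b$, every $\beta$-admissible $p$ satisfies $p\prec\mathcal P$, while for every $\beta$ with $0<\beta<b$ there is a $\beta$-admissible $p$ with $p\not\prec\mathcal P$. **Theorem.** (a) The sharp bound for $\varphi_0$ is $4(1+\sqrt2)(1-\log2)$. (b) The sharp bound for $\varphi_{\sin}$ is $\dfrac{2(1+\sin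 1)\left(\sqrt2-\log(1+\sqrt2)+\log2-1\right)}{\sin 1}$. (c) The sharp bound for $\varphi_{\rm lune}$ is $(2+\sqrt2)\left(\sqrt2-\log(1+\sqrt2)+\log2-1\right)$. (d) Let $-1<B<A<1$ and $$A_0=\frac{2-\log4-\sqrt2+\log(1+\sqrt2)}{\sqrt2-\log(1+\sqrt2)}\approx0.151764.$$ (i) If $A<A_0$, the sharp bound for $\dfrac{1+Az}{1+Bz}$ is $\dfrac{2(1-A)(1-\log2)}{A-B}$. (ii) If $A>A_0$, the sharp bound for $\dfrac{1+Az}{1+Bz}$ is $\dfrac{2(1+A)\left(\sqrt2-1+\log2-\log(1+\sqrt2)\right)}{A-B}$. -/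

import Mathlib

namespace LemniscateSubordination

noncomputable section

/-- The open unit disk of the complex plane. -/
def unitDisk : Set ℂ := Metric.ball (0 : ℂ) 1

/-- `f ≺ g` on the unit disk: `f = g ∘ w` there for some analytic `w : 𝔻 → 𝔻` with `w 0 = 0`. -/
def Subordinate (f g : ℂ → ℂ) : Prop :=
  ∃ w : ℂ → ℂ, AnalyticOnNhd ℂ w unitDisk ∧ Set.MapsTo w unitDisk unitDisk ∧ w 0 = 0 ∧
    ∀ z ∈ unitDisk, f z = g (w z)

/-- `p` is analytic on the unit disk, `p 0 = 1`, and `1 + β z p'(z) / p(z)² ≺ √(1 + z)`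
(principal branch). The subordination forces `p` to have no zero in the disk: its left side would
be unbounded near a zero of `p`, whereas its right side, evaluated along `w`, is bounded. -/
def Admissible (β : ℝ) (p : ℂ → ℂ) : Prop :=
  AnalyticOnNhd ℂ p unitDisk ∧ p 0 = 1 ∧
    Subordinate (fun z => 1 + (β : ℂ) * z * deriv p z / p z ^ 2) (fun z => Complex.sqrt (1 + z))

/-- `b` is the sharp bound on `β` for the superordinate function `P`: whenever `β ≥ b`, every
admissible `p` satisfies `p ≺ P`, and for each positive `β < b` this fails for some admissible
`p`. -/
def IsSharpBound (P : ℂ → ℂ) (b : ℝ) : Prop :=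
  (∀ β : ℝ, b ≤ β → ∀ p : ℂ → ℂ, Admissible β p → Subordinate p P) ∧
    ∀ β : ℝ, 0 < β → β < b → ∃ p : ℂ → ℂ, Admissible β p ∧ ¬ Subordinate p P

/-- The constant `k = √2 + 1`. -/
def kConst : ℝ := Real.sqrt 2 + 1

/-- The rational function `φ₀(z) = 1 + (z / k) (k + z) / (k - z)`. -/
def phiZero (z : ℂ) : ℂ :=
  1 + z / (kConst : ℂ) * (((kConst : ℂ) + z) / ((kConst : ℂ) - z))

/-- The function `1 + sin z`. -/
def phiSin (z : ℂ) : ℂ := 1 + Complex.sin z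

/-- The lune function `z + √(1 + z²)` (principal branch). -/
def phiLune (z : ℂ) : ℂ := z + Complex.sqrt (1 + z ^ 2)

/-- The Janowski function `(1 + A z) / (1 + B z)`. -/
def janowski (A B : ℝ) (z : ℂ) : ℂ := (1 + (A : ℂ) * z) / (1 + (B : ℂ) * z)

/-- The threshold `A₀ ≈ 0.151764`. -/
def thresholdA : ℝ :=
  (2 - Real.log 4 - Real.sqrt 2 + Real.log (1 + Real.sqrt 2)) /
    (Real.sqrt 2 - Real.log (1 + Real.sqrt 2))

end

end LemniscateSubordination

namespace LemniscateSubordination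

/-! ### The principal square root -/

/-! Put F = β(1 - 1/p). Then zF' = βzp'/p², so admissibility reads 1 + zF' = √(1 + w) with w a
Schwarz function. On |z| = t, |w| ≤ t, and the root maps |ζ| ≤ t into the disk with diameter
[√(1-t), √(1+t)] (`norm_sqrt_sub_le`). Integrating along a radius puts F(z), |z| = r, in the disk
with diameter [G(-r), G(r)], where G(x) = ∫₀ˣ (√(1+t)-1)/t dt (`norm_sub_primitiveReal_le`).
Inversion then puts p in any disk with real diameter [a, b] such that -G(-1) ≤ β(1/a - 1) and G(1) ≤
β(1 - 1/b) (`Admissible.inDisk`).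

For each superordinate function P, a disk with real diameter [a, b] lies in P(𝔻), and an explicit
inverse of P on it turns p into the required Schwarz function. Conversely the functions 1/(1 -
G(λz)/β) are admissible when pole-free, and their real values violate whichever endpoint inequality
fails. So the sharp bound is the larger of the two critical β, provided that end of [a, b] also
bounds the real values of P. The left end decides for φ₀ and for A < A₀, the right end in the other
cases. -/

theorem sqrt_sq (a : ℂ) : Complex.sqrt a ^ 2 = a := by
  simp [Complex.sqrt]

theorem sqrt_re_nonneg (a : ℂ) : 0 ≤ (Complex.sqrt a).re := by
  rw [Complex.sqrt, Complex.cpow_inv_two_re]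
  exact Real.sqrt_nonneg _

theorem sqrt_eq_of_sq_eq {a s : ℂ} (h : s ^ 2 = a) (hs : 0 < s.re) : Complex.sqrt a = s := by
  have h' : Complex.sqrt a ^ 2 = s ^ 2 := by rw [sqrt_sq, h]
  rcases sq_eq_sq_iff_eq_or_eq_neg.1 h' with e | e
  · exact e
  · have := sqrt_re_nonneg a
    rw [e, Complex.neg_re] at this
    linarith

theorem sqrt_re_pos {a : ℂ} (ha : 0 < a.re) : 0 < (Complex.sqrt a).re := by
  rw [Complex.sqrt, Complex.cpow_inv_two_re]
  have := norm_nonneg a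
  positivity

theorem analyticAt_sqrt {a : ℂ} (ha : a ∈ Complex.slitPlane) : AnalyticAt ℂ Complex.sqrt a := by
  unfold Complex.sqrt
  exact analyticAt_id.cpow analyticAt_const ha

/-! ### Disks with a real diameter -/

/-- The point `u` lies in the open disk having the real segment `[a, b]` as a diameter. -/
def InDisk (a b : ℝ) (u : ℂ) : Prop := (u.re - a) * (u.re - b) + u.im ^ 2 < 0

/-- Inversion preserves circles symmetric about the real axis: the defining expression at u is
ab|u|² times the one at u⁻¹. -/
theorem InDisk.inv {a b : ℝ} (ha : 0 < a) (hb : 0 < b) {u : ℂ} (h : InDisk b⁻¹ a⁻¹ u⁻¹) :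
    InDisk a b u := by
  unfold InDisk at *
  -- As 0⁻¹ = 0 here, u = 0 would turn `h` into a⁻¹b⁻¹ < 0.
  have hu : u ≠ 0 := by
    rintro rfl
    simp at h
    have : 0 < a⁻¹ * b⁻¹ := by positivity
    linarith
  have hn : 0 < Complex.normSq u := Complex.normSq_pos.2 hu
  have e : (u.re - a) * (u.re - b) + u.im ^ 2 = (a * b * Complex.normSq u) *
      ((u⁻¹.re - b⁻¹) * (u⁻¹.re - a⁻¹) + u⁻¹.im ^ 2) := by
    rw [Complex.inv_re, Complex.inv_im]
    field_simp
    rw [Complex.normSq_apply]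
    ring
  rw [e]
  exact mul_neg_of_pos_of_neg (by positivity) h

theorem InDisk.re_mem {a b : ℝ} {u : ℂ} (h : InDisk a b u) (hab : a ≤ b) :
    a < u.re ∧ u.re < b := by
  unfold InDisk at h
  constructor <;> nlinarith [sq_nonneg u.im]

/-- A closed disk with real diameter lies in every open disk over a larger segment. -/
theorem InDisk.of_closed {a b a' b' : ℝ} {u : ℂ} (ha : a' < a) (hab : a ≤ b) (hb : b < b')
    (h : (u.re - a) * (u.re - b) + u.im ^ 2 ≤ 0) : InDisk a' b' u := by
  unfold InDisk
  have h1 : a ≤ u.re := by nlinarith [sq_nonneg u.im]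
  have h2 : u.re ≤ b := by nlinarith [sq_nonneg u.im]
  nlinarith [mul_nonneg (sub_nonneg.2 h1) (sub_nonneg.2 hb.le),
    mul_nonneg (sub_nonneg.2 h2) (sub_nonneg.2 ha.le), mul_pos (sub_pos.2 ha) (sub_pos.2 hb)]

theorem closedDisk_of_norm_sub_le {a b : ℝ} {u : ℂ}
    (h : ‖u - ((a + b) / 2 : ℝ)‖ ≤ (b - a) / 2) : (u.re - a) * (u.re - b) + u.im ^ 2 ≤ 0 := by
  have h2 : ‖u - ((a + b) / 2 : ℝ)‖ ^ 2 ≤ ((b - a) / 2) ^ 2 := by gcongr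
  rw [← Complex.normSq_eq_norm_sq, Complex.normSq_apply] at h2
  simp only [Complex.sub_re, Complex.sub_im, Complex.ofReal_re, Complex.ofReal_im] at h2
  nlinarith

/-! ### The lemniscate and its primitive -/

/-- The square root maps the disk of radius `t` around `1` into the disk with diameter
`[√(1 - t), √(1 + t)]`. -/
theorem norm_sqrt_sub_le {t : ℝ} (ht0 : 0 ≤ t) (ht1 : t < 1) {ζ : ℂ} (hζ : ‖ζ‖ ≤ t) :
    ‖Complex.sqrt (1 + ζ) - ((√(1 + t) + √(1 - t)) / 2 : ℝ)‖ ≤ (√(1 + t) - √(1 - t)) / 2 := by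
  set b := √(1 + t) with hb
  set a := √(1 - t) with ha
  have hb2 : b ^ 2 = 1 + t := Real.sq_sqrt (by linarith)
  have ha2 : a ^ 2 = 1 - t := Real.sq_sqrt (by linarith)
  have hap : 0 ≤ a := Real.sqrt_nonneg _
  have hbp : 0 ≤ b := Real.sqrt_nonneg _
  have hab : a ≤ b := Real.sqrt_le_sqrt (by linarith)
  set u := Complex.sqrt (1 + ζ) with hu
  have hu2 : u ^ 2 - 1 = ζ := by rw [hu, sqrt_sq]; ring
  have hre : 0 ≤ u.re := sqrt_re_nonneg _
  rw [← hu2] at hζ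
  have h1 : ‖u ^ 2 - 1‖ ^ 2 ≤ t ^ 2 := by gcongr
  rw [← Complex.normSq_eq_norm_sq, Complex.normSq_apply] at h1
  simp only [Complex.sub_re, Complex.sub_im, Complex.one_re, Complex.one_im, pow_two,
    Complex.mul_re, Complex.mul_im] at h1
  apply abs_le_of_sq_le_sq' _ (by linarith) |>.2
  rw [← Complex.normSq_eq_norm_sq, Complex.normSq_apply]
  simp only [Complex.sub_re, Complex.sub_im, Complex.ofReal_re, Complex.ofReal_im]
  generalize u.re = x at *
  generalize u.im = y at *
  -- Since a² + b² = 2, the goal rearranges to s + c ≤ (a + b)x. The hypothesis |u² - 1| ≤ t reads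
  -- (s + 1)² - 4x² ≤ t².
  set s := x ^ 2 + y ^ 2 with hs
  set c := a * b with hc
  have hc0 : 0 ≤ c := by positivity
  have hc2 : c ^ 2 = 1 - t ^ 2 := by rw [hc, mul_pow, ha2, hb2]; ring
  have hc1 : c ≤ 1 := by nlinarith
  have hx : (s + 1) ^ 2 - 4 * x ^ 2 ≤ t ^ 2 := by nlinarith
  have hst : (s - 1) ^ 2 ≤ t ^ 2 := by nlinarith [sq_nonneg y]
  -- By `hx`, the right side minus the left is at least (1 - c)(t² - (s - 1)²)/2.
  have key : (s + c) ^ 2 ≤ ((a + b) * x) ^ 2 := by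
    have e : (a + b) ^ 2 = 2 + 2 * c := by rw [hc]; nlinarith
    rw [mul_pow, e]
    nlinarith [mul_nonneg (sub_nonneg.2 hc1) (sub_nonneg.2 hst), mul_le_mul_of_nonneg_left hx
      (by linarith : (0 : ℝ) ≤ 1 + c)]
  have key' : s + c ≤ (a + b) * x := abs_le_of_sq_le_sq' key (by positivity) |>.2
  nlinarith

/-- The real primitive `∫₀ˣ (√(1 + t) - 1) / t dt`. -/
noncomputable def primitiveReal (x : ℝ) : ℝ :=
  2 * (√(1 + x) - Real.log (1 + √(1 + x)) + Real.log 2 - 1)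

theorem primitiveReal_zero : primitiveReal 0 = 0 := by
  norm_num [primitiveReal]

theorem continuous_primitiveReal : Continuous primitiveReal := by
  unfold primitiveReal
  have : ∀ x : ℝ, 1 + √(1 + x) ≠ 0 := fun x => by positivity
  fun_prop (disch := assumption)

/-- The form 1/(1 + √(1 + x)) clears the removable singularity of (√(1 + x) - 1)/x at 0 and shows
the sign. -/
theorem hasDerivAt_primitiveReal {x : ℝ} (hx : -1 < x) :
    HasDerivAt primitiveReal (1 / (1 + √(1 + x))) x := by
  have h0 : 0 < 1 + x := by linarith
  have hs : 0 < √(1 + x) := Real.sqrt_pos.2 h0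
  have h1 : HasDerivAt (fun x : ℝ => √(1 + x)) (1 / (2 * √(1 + x))) x := by
    simpa using ((hasDerivAt_id x).const_add 1).sqrt h0.ne'
  have h2 := ((((h1.sub ((h1.const_add 1).log (by positivity))).add_const (Real.log 2)).sub_const
    1).const_mul 2)
  refine h2.congr_deriv ?_
  field_simp
  ring

theorem strictMonoOn_primitiveReal : StrictMonoOn primitiveReal (Set.Ici (-1)) := by
  refine strictMonoOn_of_deriv_pos (convex_Ici _) continuous_primitiveReal.continuousOn ?_
  intro x hx
  rw [interior_Ici] at hx
  rw [(hasDerivAt_primitiveReal hx).deriv]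
  positivity

/-- Integration along a radius of the disk inclusion `norm_sqrt_sub_le`. -/
theorem norm_sub_primitiveReal_le {F F' ω : ℝ → ℂ} {r : ℝ} (hr0 : 0 ≤ r) (hr1 : r < 1)
    (hF : ContinuousOn F (Set.Icc 0 r)) (hF0 : F 0 = 0)
    (hF' : ∀ t ∈ Set.Ioo 0 r, HasDerivAt F (F' t) t)
    (hω : ∀ t ∈ Set.Ioo 0 r, ‖ω t‖ ≤ t)
    (heq : ∀ t ∈ Set.Ioo 0 r, (t : ℂ) * F' t = Complex.sqrt (1 + ω t) - 1) :
    ‖F r - ((primitiveReal (-r) + primitiveReal r) / 2 : ℝ)‖ ≤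
      (primitiveReal r - primitiveReal (-r)) / 2 := by
  set C : ℝ → ℝ := fun t => (primitiveReal (-t) + primitiveReal t) / 2 with hC
  set R : ℝ → ℝ := fun t => (primitiveReal t - primitiveReal (-t)) / 2 with hR
  change ‖F r - (C r : ℂ)‖ ≤ R r
  have hneg : ∀ t ∈ Set.Ioo 0 r,
      HasDerivAt (fun t => primitiveReal (-t)) (-(1 / (1 + √(1 - t)))) t := by
    intro t ht
    have h := (hasDerivAt_primitiveReal (x := -t) (by linarith [ht.2])).comp t (hasDerivAt_neg t)
    simpa [sub_eq_add_neg, Function.comp_def] using h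
  have hpos : ∀ t ∈ Set.Ioo 0 r, HasDerivAt primitiveReal (1 / (1 + √(1 + t))) t := fun t ht =>
    hasDerivAt_primitiveReal (by linarith [ht.1])
  have hCc : Continuous C :=
    ((continuous_primitiveReal.comp continuous_neg).add continuous_primitiveReal).div_const 2
  have hRc : Continuous R :=
    (continuous_primitiveReal.sub (continuous_primitiveReal.comp continuous_neg)).div_const 2
  have hCd : ∀ t ∈ Set.Ioo 0 r, HasDerivAt C
      ((-(1 / (1 + √(1 - t))) + 1 / (1 + √(1 + t))) / 2) t :=
    fun t ht => ((hneg t ht).add (hpos t ht)).div_const 2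
  have hRd : ∀ t ∈ Set.Ioo 0 r, HasDerivAt R
      ((1 / (1 + √(1 + t)) - -(1 / (1 + √(1 - t)))) / 2) t :=
    fun t ht => ((hpos t ht).sub (hneg t ht)).div_const 2
  -- Testing against the fixed direction D makes the estimate scalar: g decreases because |F' - C'|
  -- ≤ R', while g(0) = 0 and g(r) = |D|² - |D|R(r).
  set D : ℂ := F r - (C r : ℂ) with hD
  set g : ℝ → ℝ := fun t => ((starRingEnd ℂ) D * (F t - (C t : ℂ))).re - ‖D‖ * R t with hg
  have hgc : ContinuousOn g (Set.Icc 0 r) := by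
    refine ContinuousOn.sub (Complex.continuous_re.comp_continuousOn (continuousOn_const.mul
      (hF.sub (Complex.continuous_ofReal.comp hCc).continuousOn))) ?_
    exact (continuous_const.mul hRc).continuousOn
  have hanti : AntitoneOn g (Set.Icc 0 r) := by
    refine antitoneOn_of_deriv_nonpos (convex_Icc _ _) hgc ?_ ?_
    all_goals rw [interior_Icc]
    · intro t ht
      have h1 := (((hF' t ht).sub (hCd t ht).ofReal_comp).const_mul ((starRingEnd ℂ) D))
      have h2 := Complex.reCLM.hasFDerivAt.comp_hasDerivAt t h1
      exact (h2.sub ((hRd t ht).const_mul ‖D‖)).differentiableAt.differentiableWithinAt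
    · intro t ht
      have h1 := (((hF' t ht).sub (hCd t ht).ofReal_comp).const_mul ((starRingEnd ℂ) D))
      have h2 := Complex.reCLM.hasFDerivAt.comp_hasDerivAt t h1
      have h3 : HasDerivAt g _ t := h2.sub ((hRd t ht).const_mul ‖D‖)
      rw [h3.deriv]
      have ht0 : 0 < t := ht.1
      have ht1 : t < 1 := ht.2.trans hr1
      have hb2 : √(1 + t) ^ 2 = 1 + t := Real.sq_sqrt (by linarith)
      have ha2 : √(1 - t) ^ 2 = 1 - t := Real.sq_sqrt (by linarith)
      have eb : 1 / (1 + √(1 + t)) = (√(1 + t) - 1) / t := by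
        field_simp; nlinarith
      have ea : 1 / (1 + √(1 - t)) = (1 - √(1 - t)) / t := by
        field_simp; nlinarith
      have hkey := norm_sqrt_sub_le ht0.le ht1 (hω t ht)
      have eF : F' t - (((-(1 / (1 + √(1 - t))) + 1 / (1 + √(1 + t))) / 2 : ℝ) : ℂ) =
          (Complex.sqrt (1 + ω t) - ((√(1 + t) + √(1 - t)) / 2 : ℝ)) / t := by
        have htc : (t : ℂ) ≠ 0 := by exact_mod_cast ht0.ne'
        rw [eq_div_iff htc, sub_mul, mul_comm (F' t), heq t ht, ea, eb]
        push_cast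
        field_simp
        ring
      have hle : ‖F' t - (((-(1 / (1 + √(1 - t))) + 1 / (1 + √(1 + t))) / 2 : ℝ) : ℂ)‖ ≤
          (1 / (1 + √(1 + t)) - -(1 / (1 + √(1 - t)))) / 2 := by
        rw [eF, norm_div, Complex.norm_real, Real.norm_of_nonneg ht0.le, ea, eb,
          div_le_iff₀ ht0]
        refine hkey.trans (le_of_eq ?_)
        field_simp
        ring
      simp only [Complex.reCLM_apply]
      refine sub_nonpos.2 ((Complex.re_le_norm _).trans ?_)
      rw [norm_mul, RCLike.norm_conj]
      exact mul_le_mul_of_nonneg_left hle (norm_nonneg _)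
  have hfin : g r ≤ g 0 := hanti (Set.left_mem_Icc.2 hr0) (Set.right_mem_Icc.2 hr0) hr0
  have hg0 : g 0 = 0 := by
    simp [hg, hF0, hC, hR, primitiveReal_zero]
  have hgr : g r = ‖D‖ ^ 2 - ‖D‖ * R r := by
    simp only [hg]
    rw [← hD, ← Complex.normSq_eq_conj_mul_self, Complex.ofReal_re, Complex.normSq_eq_norm_sq]
  rw [hg0, hgr] at hfin
  have hRr : 0 ≤ R r := by
    have := strictMonoOn_primitiveReal.monotoneOn (a := -r) (b := r) (Set.mem_Ici.2 (by linarith))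
      (Set.mem_Ici.2 (by linarith)) (by linarith)
    simp only [hR]
    linarith
  by_contra hlt
  push Not at hlt
  nlinarith

theorem mem_unitDisk {z : ℂ} : z ∈ unitDisk ↔ ‖z‖ < 1 := by
  simp [unitDisk]

/-! ### Admissible functions take values in a disk -/

theorem exists_eq_norm_mul (z : ℂ) : ∃ e : ℂ, ‖e‖ = 1 ∧ z = (‖z‖ : ℂ) * e := by
  rcases eq_or_ne z 0 with rfl | h
  · exact ⟨1, by simp, by simp⟩
  · have : (‖z‖ : ℂ) ≠ 0 := by simpa using h
    exact ⟨z / ‖z‖, by simp [h], by field_simp⟩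

theorem radius_mem_unitDisk {e : ℂ} (he : ‖e‖ = 1) {t : ℝ} (h0 : 0 ≤ t) (h1 : t < 1) :
    (t : ℂ) * e ∈ unitDisk := by
  rw [mem_unitDisk, norm_mul, he, Complex.norm_real, Real.norm_of_nonneg h0, mul_one]
  exact h1

/-- Zero-freeness is asked only on the segment [0, r]e, so that the estimate can be used up to a
hypothetical first zero. The bound on w is the Schwarz lemma. -/
theorem Admissible.norm_radius_le {β : ℝ} {p : ℂ → ℂ} (hp : Admissible β p)
    {e : ℂ} (he : ‖e‖ = 1) {r : ℝ} (hr0 : 0 ≤ r) (hr1 : r < 1)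
    (hne : ∀ t ∈ Set.Icc 0 r, p (t * e) ≠ 0) :
    ‖(β : ℂ) * (1 - (p (r * e))⁻¹) - ((primitiveReal (-r) + primitiveReal r) / 2 : ℝ)‖ ≤
      (primitiveReal r - primitiveReal (-r)) / 2 := by
  obtain ⟨hpa, hp0, w, hwa, hwm, hw0, hw⟩ := hp
  have hmem : ∀ t ∈ Set.Icc 0 r, (t : ℂ) * e ∈ unitDisk := fun t ht =>
    radius_mem_unitDisk he ht.1 (ht.2.trans_lt hr1)
  have hlin : ∀ t : ℝ, HasDerivAt (fun s : ℝ => (s : ℂ) * e) e t := fun t => by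
    simpa using ((hasDerivAt_id t).ofReal_comp).mul_const e
  have hpd : ∀ t ∈ Set.Icc 0 r,
      HasDerivAt (fun s : ℝ => p (s * e)) (deriv p (t * e) * e) t := fun t ht =>
    ((hpa _ (hmem t ht)).differentiableAt.hasDerivAt).comp_of_eq t (hlin t) rfl
  have hder : ∀ t ∈ Set.Icc 0 r, HasDerivAt (fun s : ℝ => (β : ℂ) * (1 - (p (s * e))⁻¹))
      ((β : ℂ) * (deriv p (t * e) * e / p (t * e) ^ 2)) t := by
    intro t ht
    have := (((hpd t ht).inv (hne t ht)).const_sub 1).const_mul (β : ℂ)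
    refine this.congr_deriv ?_
    ring
  refine norm_sub_primitiveReal_le (F := fun s : ℝ => (β : ℂ) * (1 - (p (s * e))⁻¹))
    (F' := fun t => (β : ℂ) * (deriv p (t * e) * e / p (t * e) ^ 2))
    (ω := fun t => w (t * e)) hr0 hr1
    (fun t ht => (hder t ht).continuousAt.continuousWithinAt) (by simp [hp0])
    (fun t ht => hder t (Set.Ioo_subset_Icc_self ht)) ?_ ?_
  · intro t ht
    have := Complex.norm_le_norm_of_mapsTo_ball (f := w) (R := 1) (z := (t : ℂ) * e)
      hwa.differentiableOn (hwm.mono_right Metric.ball_subset_closedBall) hw0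
      (mem_unitDisk.1 (hmem t (Set.Ioo_subset_Icc_self ht)))
    rwa [norm_mul, he, Complex.norm_real, Real.norm_of_nonneg ht.1.le, mul_one] at this
  · intro t ht
    have := hw _ (hmem t (Set.Ioo_subset_Icc_self ht))
    simp only at this
    rw [← this]
    ring

/-- The disk containing β(1 - q) has 0 on its diameter, so |β(1 - q)| is at most that diameter. The
resulting bound is uniform in r, which is what excludes zeros of p. -/
theorem norm_inv_le_of_norm_sub_le {β : ℝ} (hβ : 0 < β) {q : ℂ} {r c : ℝ} (hr0 : 0 ≤ r)
    (hr1 : r ≤ 1) (hc : c = (primitiveReal (-r) + primitiveReal r) / 2)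
    (h : ‖(β : ℂ) * (1 - q) - (c : ℂ)‖ ≤ (primitiveReal r - primitiveReal (-r)) / 2) :
    ‖q‖ ≤ 1 + (primitiveReal 1 - primitiveReal (-1)) / β := by
  have h1 : primitiveReal r ≤ primitiveReal 1 :=
    strictMonoOn_primitiveReal.monotoneOn (Set.mem_Ici.2 (by linarith)) (Set.mem_Ici.2
      (by norm_num)) hr1
  have h2 : primitiveReal (-1) ≤ primitiveReal (-r) :=
    strictMonoOn_primitiveReal.monotoneOn Set.self_mem_Ici (Set.mem_Ici.2
      (by linarith)) (by linarith)
  have h3 : 0 ≤ primitiveReal r := primitiveReal_zero ▸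
    strictMonoOn_primitiveReal.monotoneOn (Set.mem_Ici.2 (by norm_num)) (Set.mem_Ici.2
      (by linarith)) hr0
  have h4 : primitiveReal (-r) ≤ 0 := by
    have := strictMonoOn_primitiveReal.monotoneOn (a := -r) (b := 0) (Set.mem_Ici.2 (by linarith))
      (Set.mem_Ici.2 (by linarith)) (by linarith)
    rwa [primitiveReal_zero] at this
  have hcn : ‖(c : ℂ)‖ ≤ (primitiveReal r - primitiveReal (-r)) / 2 := by
    rw [Complex.norm_real, Real.norm_eq_abs, hc, abs_le]
    constructor <;> linarith
  have e : q = 1 - ((β : ℂ) * (1 - q) - c + c) / β := by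
    have : (β : ℂ) ≠ 0 := by exact_mod_cast hβ.ne'
    field_simp
    ring
  rw [e]
  refine (norm_sub_le _ _).trans ?_
  rw [norm_one, norm_div, Complex.norm_real, Real.norm_of_nonneg hβ.le]
  gcongr
  refine (norm_add_le _ _).trans ?_
  linarith

/-- An admissible function has no zero on the disk. -/
theorem Admissible.ne_zero_radius {β : ℝ} {p : ℂ → ℂ} (hβ : 0 < β) (hp : Admissible β p)
    {e : ℂ} (he : ‖e‖ = 1) {r : ℝ} (hr0 : 0 ≤ r) (hr1 : r < 1) : p (r * e) ≠ 0 := by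
  intro hzero
  have hc : ContinuousOn (fun t : ℝ => p (t * e)) (Set.Icc 0 r) := by
    refine hp.1.continuousOn.comp (by fun_prop) fun t ht =>
      radius_mem_unitDisk he ht.1 (ht.2.trans_lt hr1)
  have hcomp : IsCompact (Set.Icc 0 r ∩ (fun t : ℝ => p (t * e)) ⁻¹' {0}) :=
    isCompact_Icc.of_isClosed_subset (hc.preimage_isClosed_of_isClosed isClosed_Icc
      isClosed_singleton) Set.inter_subset_left
  -- At a zero the quotient in the subordination is 0 by convention and yields no contradiction.
  -- Hence a limit at the first zero t₀: before it 1 ≤ M|p|, and letting s → t₀ gives 1 ≤ 0.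
  obtain ⟨t₀, ⟨ht₀, hpt₀⟩, hmin⟩ := hcomp.exists_isLeast ⟨r, ⟨hr0, le_rfl⟩, hzero⟩
  simp only [Set.mem_preimage, Set.mem_singleton_iff] at hpt₀
  have hpos : 0 < t₀ := by
    rcases ht₀.1.eq_or_lt with h | h
    · rw [← h] at hpt₀
      simp [hp.2.1] at hpt₀
    · exact h
  set M := 1 + (primitiveReal 1 - primitiveReal (-1)) / β
  have hM : ∀ s ∈ Set.Ico 0 t₀, 1 ≤ M * ‖p (s * e)‖ := by
    intro s hs
    have hne : ∀ t ∈ Set.Icc 0 s, p (t * e) ≠ 0 := fun t ht h0 =>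
      absurd (hmin ⟨⟨ht.1, ht.2.trans (hs.2.le.trans ht₀.2)⟩, h0⟩)
        (not_le.2 (ht.2.trans_lt hs.2))
    have hs1 : s < 1 := (hs.2.trans_le ht₀.2).trans hr1
    have := norm_inv_le_of_norm_sub_le hβ hs.1 hs1.le rfl (hp.norm_radius_le he hs.1 hs1 hne)
    have hps := norm_pos_iff.2 (hne s ⟨hs.1, le_rfl⟩)
    rwa [norm_inv, inv_le_iff_one_le_mul₀ hps] at this
  have hlim : Filter.Tendsto (fun s : ℝ => M * ‖p (s * e)‖) (nhdsWithin t₀ (Set.Ico 0 t₀))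
      (nhds (M * ‖p (t₀ * e)‖)) :=
    ((hc t₀ ht₀).mono fun s hs => ⟨hs.1, hs.2.le.trans ht₀.2⟩).norm.const_mul M
  have : (nhdsWithin t₀ (Set.Ico 0 t₀)).NeBot := by
    rw [← mem_closure_iff_nhdsWithin_neBot, closure_Ico hpos.ne]
    exact ⟨hpos.le, le_rfl⟩
  have h1 := ge_of_tendsto hlim (eventually_mem_nhdsWithin.mono hM)
  rw [hpt₀] at h1
  simp at h1
  linarith

/-- The values of an admissible function lie in any disk with real diameter `[a, b]` whose
endpoints are compatible with the two extreme values of the primitive. -/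
theorem Admissible.inDisk {β a b : ℝ} {p : ℂ → ℂ} (hβ : 0 < β) (hp : Admissible β p)
    (ha : 0 < a) (hb : 0 < b) (hbot : -primitiveReal (-1) ≤ β * (a⁻¹ - 1))
    (htop : primitiveReal 1 ≤ β * (1 - b⁻¹)) {z : ℂ} (hz : z ∈ unitDisk) : InDisk a b (p z) := by
  obtain ⟨e, he, hze⟩ := exists_eq_norm_mul z
  have hr1 : ‖z‖ < 1 := mem_unitDisk.1 hz
  have hr0 := norm_nonneg z
  have h := hp.norm_radius_le he hr0 hr1 fun t ht =>
    hp.ne_zero_radius hβ he ht.1 (ht.2.trans_lt hr1)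
  rw [← hze] at h
  have hmono := strictMonoOn_primitiveReal
  have hle : primitiveReal (-‖z‖) ≤ primitiveReal ‖z‖ :=
    hmono.monotoneOn (Set.mem_Ici.2 (by linarith)) (Set.mem_Ici.2 (by linarith)) (by linarith)
  have h1 : primitiveReal ‖z‖ < primitiveReal 1 :=
    hmono (Set.mem_Ici.2 (by linarith)) (Set.mem_Ici.2 (by norm_num)) hr1
  have h2 : primitiveReal (-1) < primitiveReal (-‖z‖) :=
    hmono Set.self_mem_Ici (Set.mem_Ici.2 (by linarith)) (by linarith)
  have h3 := InDisk.of_closed (a' := -(β * (a⁻¹ - 1))) (b' := β * (1 - b⁻¹)) (by linarith) hle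
    (by linarith) (closedDisk_of_norm_sub_le h)
  refine InDisk.inv ha hb ?_
  unfold InDisk at h3 ⊢
  simp only [Complex.mul_re, Complex.mul_im, Complex.ofReal_re, Complex.ofReal_im,
    Complex.sub_re, Complex.sub_im, Complex.one_re, Complex.one_im, zero_mul, sub_zero, add_zero,
    zero_sub] at h3
  -- The affine map v ↦ β(1 - v) scales the defining expression by β².
  have e2 : ((p z)⁻¹.re - b⁻¹) * ((p z)⁻¹.re - a⁻¹) + (p z)⁻¹.im ^ 2 = (β ^ 2)⁻¹ *
      ((β * (1 - (p z)⁻¹.re) - -(β * (a⁻¹ - 1))) * (β * (1 - (p z)⁻¹.re) - β * (1 - b⁻¹)) +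
        (β * -(p z)⁻¹.im) ^ 2) := by
    field_simp
    ring
  rw [e2]
  exact mul_neg_of_pos_of_neg (by positivity) h3

/-! ### The extremal functions -/

/-- The primitive `∫₀ᶻ (√(1 + t) - 1) / t dt` on the unit disk. -/
noncomputable def primitive (z : ℂ) : ℂ :=
  2 * (Complex.sqrt (1 + z) - Complex.log (1 + Complex.sqrt (1 + z)) + Complex.log 2 - 1)

theorem one_add_re_pos {z : ℂ} (hz : z ∈ unitDisk) : 0 < (1 + z).re := by
  have h1 := Complex.abs_re_le_norm z
  have h2 := mem_unitDisk.1 hz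
  rw [Complex.add_re, Complex.one_re]
  linarith [(abs_le.1 h1).1]

theorem primitive_ofReal {x : ℝ} (hx : -1 < x) : primitive x = primitiveReal x := by
  have h : Complex.sqrt (1 + x) = (√(1 + x) : ℝ) := by
    refine sqrt_eq_of_sq_eq ?_ ?_
    · rw [← Complex.ofReal_pow, Real.sq_sqrt (by linarith)]
      push_cast; ring
    · rw [Complex.ofReal_re]
      exact Real.sqrt_pos.2 (by linarith)
  have h2 : Complex.log (1 + (√(1 + x) : ℝ)) = (Real.log (1 + √(1 + x)) : ℝ) := by
    rw [Complex.ofReal_log (by positivity)]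
    push_cast; rfl
  have h3 : Complex.log 2 = (Real.log 2 : ℝ) := by
    rw [Complex.ofReal_log (by norm_num)]
    push_cast; rfl
  rw [primitive, primitiveReal, h, h2, h3]
  push_cast
  ring

theorem analyticOnNhd_primitive : AnalyticOnNhd ℂ primitive unitDisk := by
  intro z hz
  have h1 : AnalyticAt ℂ (fun z : ℂ => Complex.sqrt (1 + z)) z :=
    (analyticAt_sqrt (Or.inl (one_add_re_pos hz))).fun_comp (analyticAt_const.add analyticAt_id)
  have h2 : AnalyticAt ℂ (fun z : ℂ => Complex.log (1 + Complex.sqrt (1 + z))) z := by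
    refine (analyticAt_const.add h1).clog (Or.inl ?_)
    have := sqrt_re_nonneg (1 + z)
    change 0 < (1 + Complex.sqrt (1 + z)).re
    simp only [Complex.add_re, Complex.one_re]
    linarith
  exact analyticAt_const.mul (((h1.sub h2).add analyticAt_const).sub analyticAt_const)

/-- With s = √(1 + z), the derivative is 2s'(1 - 1/(1 + s)) = 1/(1 + s), and z = (s - 1)(s + 1). -/
theorem mul_deriv_primitive {z : ℂ} (hz : z ∈ unitDisk) :
    z * deriv primitive z = Complex.sqrt (1 + z) - 1 := by
  have hre := one_add_re_pos hz
  have hs := sqrt_re_pos hre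
  have hs2 := sqrt_sq (1 + z)
  have hs0 : Complex.sqrt (1 + z) ≠ 0 := by
    intro h; simp [h] at hs
  have hs1 : 1 + Complex.sqrt (1 + z) ≠ 0 := by
    intro h
    have := congrArg Complex.re h
    simp only [Complex.add_re, Complex.one_re, Complex.zero_re] at this
    linarith
  have hd : DifferentiableAt ℂ (fun z : ℂ => Complex.sqrt (1 + z)) z :=
    ((analyticAt_sqrt (Or.inl hre)).fun_comp (analyticAt_const.add analyticAt_id)).differentiableAt
  have hd' := hd.hasDerivAt
  set d := deriv (fun z : ℂ => Complex.sqrt (1 + z)) z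
  have hsq : 2 * Complex.sqrt (1 + z) * d = 1 := by
    have h1 : HasDerivAt (fun z : ℂ => Complex.sqrt (1 + z) ^ 2) _ z := hd'.pow 2
    have h2 : HasDerivAt (fun z : ℂ => Complex.sqrt (1 + z) ^ 2) 1 z := by
      simp only [sqrt_sq]
      simpa using (hasDerivAt_id z).const_add 1
    simpa using h1.unique h2
  have hG : HasDerivAt primitive _ z :=
    ((((hd'.sub ((hd'.const_add 1).clog (Or.inl (by
      simp only [Complex.add_re, Complex.one_re]; linarith)))).add_const
      (Complex.log 2)).sub_const 1).const_mul 2)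
  rw [hG.deriv]
  have ed : d = 1 / (2 * Complex.sqrt (1 + z)) := by
    rw [eq_div_iff (by simpa using hs0), mul_comm]; exact hsq
  rw [ed]
  set s := Complex.sqrt (1 + z)
  have ez : z = s ^ 2 - 1 := by rw [hs2]; ring
  rw [ez]
  field_simp
  ring

/-- The radial estimate applied to the primitive itself, with w(z) = z. It rules out poles of the
extremal functions. -/
theorem primitive_re_le {z : ℂ} (hz : z ∈ unitDisk) : (primitive z).re ≤ primitiveReal ‖z‖ := by
  obtain ⟨e, he, hze⟩ := exists_eq_norm_mul z
  have hr1 : ‖z‖ < 1 := mem_unitDisk.1 hz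
  have hr0 := norm_nonneg z
  have hmem : ∀ t ∈ Set.Icc 0 ‖z‖, (t : ℂ) * e ∈ unitDisk := fun t ht =>
    radius_mem_unitDisk he ht.1 (ht.2.trans_lt hr1)
  have hder : ∀ t ∈ Set.Icc 0 ‖z‖,
      HasDerivAt (fun s : ℝ => primitive (s * e)) (deriv primitive (t * e) * e) t := fun t ht =>
    ((analyticOnNhd_primitive _ (hmem t ht)).differentiableAt.hasDerivAt).comp_of_eq t
      (by simpa using ((hasDerivAt_id t).ofReal_comp).mul_const e) rfl
  have h := norm_sub_primitiveReal_le (F := fun s : ℝ => primitive (s * e))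
    (F' := fun t => deriv primitive (t * e) * e) (ω := fun t => t * e) hr0 hr1
    (fun t ht => (hder t ht).continuousAt.continuousWithinAt)
    (by have := primitive_ofReal (x := 0) (by norm_num)
        simpa [primitiveReal_zero] using this)
    (fun t ht => hder t (Set.Ioo_subset_Icc_self ht))
    (fun t ht => by
      rw [norm_mul, he, Complex.norm_real, Real.norm_of_nonneg ht.1.le, mul_one])
    (fun t ht => by
      rw [← mul_deriv_primitive (hmem t (Set.Ioo_subset_Icc_self ht))]
      ring)
  simp only [← hze] at h
  have h2 := (Complex.re_le_norm _).trans h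
  simp only [Complex.sub_re, Complex.ofReal_re] at h2
  linarith

/-- The function `1 / (1 - G(λ z) / β)`, with `G` the primitive, is admissible as long as it has no
pole. -/
theorem admissible_extremal {β l : ℝ} (hβ : 0 < β) (hl0 : 0 < l) (hl1 : l ≤ 1)
    (hl : primitiveReal l < β) : Admissible β (fun z => (1 - primitive (l * z) / β)⁻¹) := by
  have hmem : ∀ z ∈ unitDisk, (l : ℂ) * z ∈ unitDisk := fun z hz => by
    rw [mem_unitDisk] at *
    rw [norm_mul, Complex.norm_real, Real.norm_of_nonneg hl0.le]
    nlinarith [norm_nonneg z]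
  have hβ' : (β : ℂ) ≠ 0 := by exact_mod_cast hβ.ne'
  -- A pole would need a value β of the primitive, whose real part here is at most G(l) < β.
  have hne : ∀ z ∈ unitDisk, 1 - primitive (l * z) / β ≠ 0 := by
    intro z hz h0
    have e : primitive (l * z) = β := by
      simpa using ((eq_div_iff hβ').1 (sub_eq_zero.1 h0)).symm
    have h1 := primitive_re_le (hmem z hz)
    rw [e, Complex.ofReal_re, norm_mul, Complex.norm_real, Real.norm_of_nonneg hl0.le] at h1
    have h2 : primitiveReal (l * ‖z‖) ≤ primitiveReal l := by
      have := norm_nonneg z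
      have hz1 := mem_unitDisk.1 hz
      refine strictMonoOn_primitiveReal.monotoneOn (Set.mem_Ici.2 (by nlinarith))
        (Set.mem_Ici.2 (by linarith)) (by nlinarith)
    linarith
  have han : ∀ z ∈ unitDisk, AnalyticAt ℂ (fun z => 1 - primitive (l * z) / β) z := fun z hz =>
    analyticAt_const.sub (((analyticOnNhd_primitive _ (hmem z hz)).fun_comp
      (analyticAt_const.mul analyticAt_id)).div analyticAt_const hβ')
  have h00 : primitive 0 = 0 := by
    have := primitive_ofReal (x := 0) (by norm_num)
    simpa [primitiveReal_zero] using this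
  refine ⟨fun z hz => (han z hz).inv (hne z hz), by simp [h00], fun z => l * z,
    fun z _ => analyticAt_const.mul analyticAt_id, hmem, by simp, ?_⟩
  intro z hz
  have hd1 : HasDerivAt (fun z => primitive (l * z)) (deriv primitive (l * z) * l) z :=
    ((analyticOnNhd_primitive _ (hmem z hz)).differentiableAt.hasDerivAt).comp_of_eq z
      (by simpa using (hasDerivAt_id z).const_mul (l : ℂ)) rfl
  have hd2 : HasDerivAt (fun z => (1 - primitive (l * z) / β)⁻¹) _ z :=
    ((hd1.div_const (β : ℂ)).const_sub 1).inv (hne z hz)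
  have hm : Complex.sqrt (1 + l * z) = 1 + l * z * deriv primitive (l * z) := by
    rw [mul_deriv_primitive (hmem z hz)]; ring
  have hn := hne z hz
  simp only
  rw [hd2.deriv, hm]
  set D := 1 - primitive (l * z) / β
  field_simp

/-! ### Sharpness and the two criteria -/

/-- If the real values of `P` on the disk are at most `b` but the extremal functions exceed `b`,
some admissible function is not subordinate to `P`. -/
theorem exists_not_subordinate_of_lt_top {β b : ℝ} {P : ℂ → ℂ} (hβ : 0 < β) (hb : 1 < b)
    (hP : ∀ z ∈ unitDisk, ∀ x : ℝ, P z = x → x < b) (h : β * (1 - b⁻¹) < primitiveReal 1) :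
    ∃ p, Admissible β p ∧ ¬ Subordinate p P := by
  have hb' : b⁻¹ < 1 := inv_lt_one_of_one_lt₀ hb
  have hbp : 0 < b⁻¹ := by positivity
  -- Solve G(l) = v and G(x) = u. Taking v < β avoids a pole even if β ≤ G(1); u < v puts x/l in the
  -- disk, where the extremal function equals 1/(1 - u/β) > b.
  obtain ⟨v, hv1, hv2⟩ := exists_between (lt_min h (by nlinarith : β * (1 - b⁻¹) < β))
  obtain ⟨u, hu1, hu2⟩ := exists_between hv1
  have hv0 : 0 < u := lt_trans (by apply mul_pos hβ; linarith) hu1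
  have hIVT := intermediate_value_Ioo (zero_le_one' ℝ) continuous_primitiveReal.continuousOn
  rw [primitiveReal_zero] at hIVT
  obtain ⟨l, hl, rfl⟩ := hIVT ⟨hv0.trans hu2, hv2.trans_le (min_le_left _ _)⟩
  obtain ⟨x, hx, rfl⟩ := hIVT ⟨hv0, hu2.trans (hv2.trans_le (min_le_left _ _))⟩
  have hxl : x < l := (strictMonoOn_primitiveReal.lt_iff_lt (Set.mem_Ici.2 (by linarith [hx.1]))
    (Set.mem_Ici.2 (by linarith [hl.1]))).1 hu2
  have hl0 : 0 < l := hl.1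
  refine ⟨_, admissible_extremal hβ hl.1 hl.2.le (hv2.trans_le (min_le_right _ _)), ?_⟩
  rintro ⟨w, -, hwm, -, hw⟩
  have hz : ((x / l : ℝ) : ℂ) ∈ unitDisk := by
    rw [mem_unitDisk, Complex.norm_real, Real.norm_of_nonneg (div_pos hx.1 hl0).le]
    exact (div_lt_one hl0).2 hxl
  have e := hw _ hz
  have e2 : (l : ℂ) * ((x / l : ℝ) : ℂ) = x := by
    rw [← Complex.ofReal_mul]
    congr 1
    field_simp
  simp only at e
  rw [e2, primitive_ofReal (by linarith [hx.1])] at e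
  have h1 := hP _ (hwm hz) (1 - primitiveReal x / β)⁻¹ (by rw [← e]; push_cast; ring)
  have h2 : 0 < 1 - primitiveReal x / β := by
    rw [sub_pos, div_lt_one hβ]
    exact hu2.trans (hv2.trans_le (min_le_right _ _))
  have h3 := (inv_lt_comm₀ h2 (by linarith)).1 h1
  have h4 : 1 - b⁻¹ < primitiveReal x / β := by
    rw [lt_div_iff₀ hβ]; linarith
  linarith

/-- If the real values of `P` on the disk are at least `a` but the extremal functions fall below
`a`, some admissible function is not subordinate to `P`. -/
theorem exists_not_subordinate_of_lt_bot {β a : ℝ} {P : ℂ → ℂ} (hβ : 0 < β) (ha0 : 0 < a)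
    (ha : a < 1) (hP : ∀ z ∈ unitDisk, ∀ x : ℝ, P z = x → a < x)
    (htop : primitiveReal 1 < β) (h : β * (a⁻¹ - 1) < -primitiveReal (-1)) :
    ∃ p, Admissible β p ∧ ¬ Subordinate p P := by
  have ha' : 1 < a⁻¹ := (one_lt_inv₀ ha0).2 ha
  obtain ⟨v, hv1, hv2⟩ := exists_between h
  have hIVT := intermediate_value_Ioo (by norm_num : (-1 : ℝ) ≤ 0)
    continuous_primitiveReal.continuousOn
  rw [primitiveReal_zero] at hIVT
  have hv0 : 0 < v := lt_trans (by apply mul_pos hβ; linarith) hv1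
  -- No dilation is needed as G(1) < β; at x the extremal function equals 1/(1 + v/β) < a.
  obtain ⟨x, hx, hxv⟩ := hIVT ⟨(by linarith : primitiveReal (-1) < -v), by linarith⟩
  refine ⟨_, admissible_extremal hβ one_pos le_rfl htop, ?_⟩
  rintro ⟨w, -, hwm, -, hw⟩
  have hz : (x : ℂ) ∈ unitDisk := by
    rw [mem_unitDisk, Complex.norm_real, Real.norm_eq_abs, abs_lt]
    exact ⟨hx.1, by linarith [hx.2]⟩
  have e := hw _ hz
  simp only [Complex.ofReal_one, one_mul] at e
  rw [primitive_ofReal hx.1] at e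
  have h1 := hP _ (hwm hz) (1 - primitiveReal x / β)⁻¹ (by rw [← e]; push_cast; ring)
  rw [hxv] at h1
  have h4 : a⁻¹ - 1 < v / β := by
    rw [lt_div_iff₀ hβ]; linarith
  have h2 : 0 < 1 - -v / β := by
    rw [neg_div]; linarith
  have h3 := (lt_inv_comm₀ ha0 h2).1 h1
  rw [neg_div] at h3
  linarith

/-- Criterion for a sharp bound attained at the right end of the diameter. -/
theorem isSharpBound_of_top {P : ℂ → ℂ} {a b c : ℝ} (ha : 0 < a) (ha1 : a < 1) (hb : 1 < b)
    (hP : ∀ z ∈ unitDisk, ∀ x : ℝ, P z = x → x < b)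
    (hsub : ∀ p : ℂ → ℂ, AnalyticOnNhd ℂ p unitDisk → p 0 = 1 →
      (∀ z ∈ unitDisk, InDisk a b (p z)) → Subordinate p P)
    (hc : c * (1 - b⁻¹) = primitiveReal 1) (hbot : -primitiveReal (-1) ≤ c * (a⁻¹ - 1)) :
    IsSharpBound P c := by
  have hb' : b⁻¹ < 1 := inv_lt_one_of_one_lt₀ hb
  have ha' : 1 < a⁻¹ := (one_lt_inv₀ ha).2 ha1
  have hG1 : 0 < primitiveReal 1 := primitiveReal_zero ▸
    strictMonoOn_primitiveReal (Set.mem_Ici.2 (by norm_num)) (Set.mem_Ici.2 (by norm_num)) one_pos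
  have hc0 : 0 < c := by nlinarith
  refine ⟨fun β hβ p hp => hsub p hp.1 hp.2.1 fun z hz =>
    hp.inDisk (hc0.trans_le hβ) ha (by linarith) (by nlinarith) (by nlinarith) hz,
    fun β hβ0 hβ => exists_not_subordinate_of_lt_top hβ0 hb hP (by nlinarith)⟩

/-- Criterion for a sharp bound attained at the left end of the diameter. -/
theorem isSharpBound_of_bot {P : ℂ → ℂ} {a b c : ℝ} (ha : 0 < a) (ha1 : a < 1) (hb : 1 < b)
    (hP : ∀ z ∈ unitDisk, ∀ x : ℝ, P z = x → a < x ∧ x < b)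
    (hsub : ∀ p : ℂ → ℂ, AnalyticOnNhd ℂ p unitDisk → p 0 = 1 →
      (∀ z ∈ unitDisk, InDisk a b (p z)) → Subordinate p P)
    (hc : c * (a⁻¹ - 1) = -primitiveReal (-1)) (htop : primitiveReal 1 ≤ c * (1 - b⁻¹)) :
    IsSharpBound P c := by
  have hb' : b⁻¹ < 1 := inv_lt_one_of_one_lt₀ hb
  have hb0 : 0 < b⁻¹ := by positivity
  have ha' : 1 < a⁻¹ := (one_lt_inv₀ ha).2 ha1
  have hG1 : primitiveReal (-1) < 0 := by
    have := strictMonoOn_primitiveReal (a := -1) (b := 0) Set.self_mem_Ici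
      (Set.mem_Ici.2 (by norm_num)) (by norm_num)
    rwa [primitiveReal_zero] at this
  have hc0 : 0 < c := by nlinarith
  refine ⟨fun β hβ p hp => hsub p hp.1 hp.2.1 fun z hz =>
    hp.inDisk (hc0.trans_le hβ) ha (by linarith) (by nlinarith) (by nlinarith) hz,
    fun β hβ0 hβ => ?_⟩
  -- If the right end does not already fail, then G(1) ≤ β(1 - 1/b) < β, the pole-free condition
  -- needed at the left end.
  by_cases h : β * (1 - b⁻¹) < primitiveReal 1
  · exact exists_not_subordinate_of_lt_top hβ0 hb (fun z hz x hx => (hP z hz x hx).2) h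
  · push Not at h
    exact exists_not_subordinate_of_lt_bot hβ0 ha ha1 (fun z hz x hx => (hP z hz x hx).1)
      (by nlinarith) (by nlinarith)

/-! ### Endpoint values and numerical estimates -/

theorem primitiveReal_one :
    primitiveReal 1 = 2 * (√2 - Real.log (1 + √2) + Real.log 2 - 1) := by
  norm_num [primitiveReal]

theorem primitiveReal_neg_one : primitiveReal (-1) = 2 * (Real.log 2 - 1) := by
  norm_num [primitiveReal]

theorem sqrt_two_bounds : 1.414 < √2 ∧ √2 < 1.4143 := by
  constructor
  · exact Real.lt_sqrt_of_sq_lt (by norm_num)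
  · rw [Real.sqrt_lt' (by norm_num)]; norm_num

theorem log_one_add_sqrt_two_bounds :
    Real.log 2 ≤ Real.log (1 + √2) ∧ Real.log (1 + √2) ≤ 0.9 := by
  have h := sqrt_two_bounds
  constructor
  · exact Real.log_le_log (by norm_num) (by linarith)
  · rw [Real.log_le_iff_le_exp (by positivity)]
    have e : Real.exp 0.9 = Real.exp 1 * Real.exp (-0.1) := by
      rw [← Real.exp_add]; norm_num
    have h1 := Real.exp_one_gt_d9
    have h2 := Real.add_one_le_exp (-0.1 : ℝ)
    rw [e]
    nlinarith

/-! ### Janowski functions -/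

/-- The inverse Janowski map is u ↦ (u - 1)/(A - Bu), and |u - 1|² - |A - Bu|² is 1 - B² times the
defining expression of the disk. -/
theorem norm_lt_norm_iff_inDisk {A B : ℝ} (hB : -1 < B) (hB1 : B < 1) (u : ℂ) :
    ‖u - 1‖ < ‖(A : ℂ) - B * u‖ ↔ InDisk ((1 - A) / (1 - B)) ((1 + A) / (1 + B)) u := by
  have h1 : 0 < 1 - B := by linarith
  have h2 : 0 < 1 + B := by linarith
  rw [← sq_lt_sq₀ (norm_nonneg _) (norm_nonneg _), ← Complex.normSq_eq_norm_sq,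
    ← Complex.normSq_eq_norm_sq, Complex.normSq_apply, Complex.normSq_apply, InDisk]
  simp only [Complex.sub_re, Complex.sub_im, Complex.mul_re, Complex.mul_im, Complex.ofReal_re,
    Complex.ofReal_im, Complex.one_re, Complex.one_im, zero_mul, sub_zero, add_zero, zero_sub]
  have e : (u.re - (1 - A) / (1 - B)) * (u.re - (1 + A) / (1 + B)) + u.im ^ 2 =
      ((u.re - 1) * (u.re - 1) + u.im * u.im -
        ((A - B * u.re) * (A - B * u.re) + -(B * u.im) * -(B * u.im))) *
        ((1 - B) * (1 + B))⁻¹ := by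
    field_simp
    ring
  rw [e]
  have : 0 < ((1 - B) * (1 + B))⁻¹ := by positivity
  constructor
  · intro h
    exact mul_neg_of_neg_of_pos (by linarith) this
  · intro h
    have := neg_of_mul_neg_left h this.le
    linarith

theorem subordinate_janowski {A B : ℝ} (hB : -1 < B) (hAB : B < A) (hA : A < 1) {p : ℂ → ℂ}
    (hp : AnalyticOnNhd ℂ p unitDisk) (hp0 : p 0 = 1)
    (h : ∀ z ∈ unitDisk, InDisk ((1 - A) / (1 - B)) ((1 + A) / (1 + B)) (p z)) :
    Subordinate p (janowski A B) := by
  have hlt := fun z hz => (norm_lt_norm_iff_inDisk hB (hAB.trans hA) _).2 (h z hz)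
  have hne : ∀ z ∈ unitDisk, (A : ℂ) - B * p z ≠ 0 := fun z hz =>
    norm_pos_iff.1 ((norm_nonneg _).trans_lt (hlt z hz))
  refine ⟨fun z => (p z - 1) / (A - B * p z), fun z hz => ?_, fun z hz => ?_, by simp [hp0], ?_⟩
  · exact ((hp z hz).sub analyticAt_const).div
      (analyticAt_const.sub (analyticAt_const.mul (hp z hz))) (hne z hz)
  · rw [mem_unitDisk, norm_div, div_lt_one (norm_pos_iff.2 (hne z hz))]
    exact hlt z hz
  · intro z hz
    have hd := hne z hz
    have hAB' : (A : ℂ) - B ≠ 0 := by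
      rw [← Complex.ofReal_sub]
      exact_mod_cast (sub_pos.2 hAB).ne'
    change p z = janowski A B ((p z - 1) / (A - B * p z))
    obtain ⟨q, hq⟩ : ∃ q, q = (A : ℂ) - B * p z := ⟨_, rfl⟩
    rw [← hq] at hd ⊢
    have e1 : 1 + (A : ℂ) * ((p z - 1) / q) = p z * (A - B) / q := by
      field_simp
      rw [hq]
      ring
    have e2 : 1 + (B : ℂ) * ((p z - 1) / q) = (A - B) / q := by
      field_simp
      rw [hq]
      ring
    rw [janowski, e1, e2]
    field_simp

theorem janowski_real_mem {A B : ℝ} (hB : -1 < B) (hAB : B < A) (hA : A < 1) {z : ℂ}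
    (hz : z ∈ unitDisk) {x : ℝ} (hx : janowski A B z = x) :
    (1 - A) / (1 - B) < x ∧ x < (1 + A) / (1 + B) := by
  have hz1 := mem_unitDisk.1 hz
  have hd : 1 + (B : ℂ) * z ≠ 0 := by
    intro h0
    have h1 : ‖(B : ℂ) * z‖ = 1 := by
      rw [eq_neg_of_add_eq_zero_right h0, norm_neg, norm_one]
    rw [norm_mul, Complex.norm_real, Real.norm_eq_abs] at h1
    have h2 : |B| < 1 := abs_lt.2 ⟨hB, hAB.trans hA⟩
    nlinarith [norm_nonneg z, abs_nonneg B]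
  rw [janowski, div_eq_iff hd] at hx
  have e : (x : ℂ) - 1 = ((A : ℂ) - B * x) * z := by linear_combination -hx
  have hne : (A : ℂ) - B * x ≠ 0 := by
    intro h0
    rw [h0, zero_mul, sub_eq_zero] at e
    rw [e] at h0
    have : A - B = 0 := by exact_mod_cast (by simpa using h0 : (A : ℂ) - B = 0)
    linarith
  have hlt : ‖(x : ℂ) - 1‖ < ‖(A : ℂ) - B * x‖ := by
    rw [e, norm_mul]
    exact mul_lt_of_lt_one_right (norm_pos_iff.2 hne) hz1
  have h1 : (1 - A) / (1 - B) ≤ (1 + A) / (1 + B) := by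
    rw [div_le_div_iff₀ (by linarith) (by linarith)]
    nlinarith
  simpa using ((norm_lt_norm_iff_inDisk hB (hAB.trans hA) _).1 hlt).re_mem h1

/-- A₀ is where the critical β of both ends agree: G(1)(1 + A) = -G(-1)(1 - A). -/
theorem mul_thresholdA : thresholdA * (primitiveReal 1 - primitiveReal (-1)) =
    -primitiveReal (-1) - primitiveReal 1 := by
  have h1 := log_one_add_sqrt_two_bounds
  have h2 := sqrt_two_bounds
  have h4 : Real.log 4 = 2 * Real.log 2 := by
    rw [show (4 : ℝ) = 2 ^ 2 by norm_num, Real.log_pow]; norm_num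
  have hne : √2 - Real.log (1 + √2) ≠ 0 := by
    have : 0 < √2 - Real.log (1 + √2) := by linarith
    exact this.ne'
  rw [thresholdA, primitiveReal_one, primitiveReal_neg_one, h4]
  field_simp
  ring

theorem isSharpBound_janowski_of_lt {A B : ℝ} (hB : -1 < B) (hAB : B < A) (hA : A < 1)
    (hA0 : A < thresholdA) :
    IsSharpBound (janowski A B) (2 * (1 - A) * (1 - Real.log 2) / (A - B)) := by
  have h1 : 0 < 1 - A := by linarith
  have h2 : 0 < 1 + A := by linarith
  have h3 : 0 < 1 - B := by linarith
  have h4 : 0 < 1 + B := by linarith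
  have h5 : 0 < A - B := by linarith
  have hG : 0 < primitiveReal 1 - primitiveReal (-1) := sub_pos.2
    (strictMonoOn_primitiveReal Set.self_mem_Ici (Set.mem_Ici.2 (by norm_num)) (by norm_num))
  refine isSharpBound_of_bot (a := (1 - A) / (1 - B)) (b := (1 + A) / (1 + B)) (by positivity)
    (by rw [div_lt_one h3]; linarith) (by rw [one_lt_div h4]; linarith)
    (fun z hz x hx => janowski_real_mem hB hAB hA hz hx)
    (fun p hp hp0 h => subordinate_janowski hB hAB hA hp hp0 h) ?_ ?_
  · rw [primitiveReal_neg_one]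
    field_simp
    ring
  · have e : 2 * (1 - A) * (1 - Real.log 2) / (A - B) * (1 - ((1 + A) / (1 + B))⁻¹) =
        -primitiveReal (-1) * (1 - A) / (1 + A) := by
      rw [primitiveReal_neg_one]
      field_simp
      ring
    rw [e, le_div_iff₀ h2]
    nlinarith [mul_thresholdA, mul_lt_mul_of_pos_right hA0 hG]

theorem isSharpBound_janowski_of_gt {A B : ℝ} (hB : -1 < B) (hAB : B < A) (hA : A < 1)
    (hA0 : thresholdA < A) :
    IsSharpBound (janowski A B)
      (2 * (1 + A) * (√2 - 1 + Real.log 2 - Real.log (1 + √2)) / (A - B)) := by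
  have h1 : 0 < 1 - A := by linarith
  have h2 : 0 < 1 + A := by linarith
  have h3 : 0 < 1 - B := by linarith
  have h4 : 0 < 1 + B := by linarith
  have h5 : 0 < A - B := by linarith
  have hG : 0 < primitiveReal 1 - primitiveReal (-1) := sub_pos.2
    (strictMonoOn_primitiveReal Set.self_mem_Ici (Set.mem_Ici.2 (by norm_num)) (by norm_num))
  refine isSharpBound_of_top (a := (1 - A) / (1 - B)) (b := (1 + A) / (1 + B)) (by positivity)
    (by rw [div_lt_one h3]; linarith) (by rw [one_lt_div h4]; linarith)
    (fun z hz x hx => (janowski_real_mem hB hAB hA hz hx).2)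
    (fun p hp hp0 h => subordinate_janowski hB hAB hA hp hp0 h) ?_ ?_
  · rw [primitiveReal_one]
    field_simp
    ring
  · have e : 2 * (1 + A) * (√2 - 1 + Real.log 2 - Real.log (1 + √2)) / (A - B) *
        (((1 - A) / (1 - B))⁻¹ - 1) = primitiveReal 1 * (1 + A) / (1 - A) := by
      rw [primitiveReal_one]
      field_simp
      ring
    rw [e, le_div_iff₀ h1]
    nlinarith [mul_thresholdA, mul_lt_mul_of_pos_right hA0 hG]

/-! ### The lune -/

/-- The inverse of the lune map is u ↦ (u - 1/u)/2. The condition |u² - 1| < 2|u| with Re u > 0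
describes the lune |u - 1| < √2 < |u + 1|, which contains the disk of centre √2 and radius 1. -/
theorem subordinate_phiLune {p : ℂ → ℂ} (hp : AnalyticOnNhd ℂ p unitDisk) (hp0 : p 0 = 1)
    (h : ∀ z ∈ unitDisk, InDisk (√2 - 1) (√2 + 1) (p z)) : Subordinate p phiLune := by
  have hs := sqrt_two_bounds
  have hs2 : √2 ^ 2 = 2 := Real.sq_sqrt (by norm_num)
  have hre : ∀ z ∈ unitDisk, 0 < (p z).re := fun z hz => by
    linarith [((h z hz).re_mem (by linarith)).1]
  have hne : ∀ z ∈ unitDisk, p z ≠ 0 := fun z hz h0 => by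
    have := hre z hz
    simp [h0] at this
  refine ⟨fun z => (p z ^ 2 - 1) / (2 * p z), fun z hz => ?_, fun z hz => ?_, by simp [hp0], ?_⟩
  · exact (((hp z hz).pow 2).sub analyticAt_const).div (analyticAt_const.mul (hp z hz))
      (mul_ne_zero two_ne_zero (hne z hz))
  · have h1 := h z hz
    have h2 := h1.re_mem (by linarith)
    have hx := hre z hz
    rw [mem_unitDisk, norm_div, div_lt_one (norm_pos_iff.2 (mul_ne_zero two_ne_zero (hne z hz))),
      ← sq_lt_sq₀ (norm_nonneg _) (norm_nonneg _), ← Complex.normSq_eq_norm_sq,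
      ← Complex.normSq_eq_norm_sq, Complex.normSq_apply, Complex.normSq_apply]
    rw [InDisk] at h1
    simp only [Complex.sub_re, Complex.sub_im, Complex.mul_re, Complex.mul_im, Complex.re_ofNat,
      Complex.im_ofNat, Complex.one_re, Complex.one_im, zero_mul, sub_zero, add_zero, pow_two]
    simp only [pow_two] at h1
    generalize (p z).re = x at *
    generalize (p z).im = y at *
    have k1 : x ^ 2 + y ^ 2 - 1 < 2 * x := by nlinarith
    have k2 : -(2 * x) < x ^ 2 + y ^ 2 - 1 := by nlinarith [sq_nonneg (x - 0.41), sq_nonneg y]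
    nlinarith [mul_pos (sub_pos.2 k1) (by linarith : 0 < 2 * x + (x ^ 2 + y ^ 2 - 1))]
  · intro z hz
    have hpz := hne z hz
    have e : Complex.sqrt (1 + ((p z ^ 2 - 1) / (2 * p z)) ^ 2) = (p z + (p z)⁻¹) / 2 := by
      refine sqrt_eq_of_sq_eq ?_ ?_
      · field_simp; ring
      · have := hre z hz
        have hn := Complex.normSq_pos.2 hpz
        rw [show (p z + (p z)⁻¹) / 2 = (p z + (p z)⁻¹) * ((1 / 2 : ℝ) : ℂ) by push_cast; ring,
          Complex.re_mul_ofReal, Complex.add_re, Complex.inv_re]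
        positivity
    rw [phiLune, e]
    field_simp
    ring

/-- Squaring √(1 + z²) = x - z gives x² - 1 = 2xz, hence |x² - 1| < 2x for positive x. -/
theorem phiLune_real_lt {z : ℂ} (hz : z ∈ unitDisk) {x : ℝ} (hx : phiLune z = x) :
    x < √2 + 1 := by
  have hs := sqrt_two_bounds
  have hs2 : √2 ^ 2 = 2 := Real.sq_sqrt (by norm_num)
  have hz1 := mem_unitDisk.1 hz
  have hsq := sqrt_sq (1 + z ^ 2)
  have e1 : Complex.sqrt (1 + z ^ 2) = x - z := by rw [← hx, phiLune]; ring
  rw [e1] at hsq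
  have e2 : (x : ℂ) ^ 2 - 1 = 2 * x * z := by linear_combination hsq
  have hn := congrArg norm e2
  have e3 : (x : ℂ) ^ 2 - 1 = ((x ^ 2 - 1 : ℝ) : ℂ) := by push_cast; ring
  rw [e3, norm_mul, norm_mul, Complex.norm_real, Complex.norm_real, Real.norm_eq_abs,
    Real.norm_eq_abs, Complex.norm_ofNat] at hn
  by_contra! hle
  have hx0 : 0 < x := by linarith
  have h1 := le_abs_self (x ^ 2 - 1)
  rw [hn, abs_of_pos hx0] at h1
  nlinarith [norm_nonneg z, mul_pos hx0 (sub_pos.2 hz1)]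

theorem isSharpBound_phiLune : IsSharpBound phiLune
    ((2 + √2) * (√2 - Real.log (1 + √2) + Real.log 2 - 1)) := by
  have hs := sqrt_two_bounds
  have hs2 : √2 ^ 2 = 2 := Real.sq_sqrt (by norm_num)
  have hl := log_one_add_sqrt_two_bounds
  have hl2 := Real.log_two_gt_d9
  have hi : (√2 + 1)⁻¹ = √2 - 1 := inv_eq_of_mul_eq_one_right (by linear_combination hs2)
  have hi' : (√2 - 1)⁻¹ = √2 + 1 := by rw [← hi, inv_inv]
  refine isSharpBound_of_top (a := √2 - 1) (b := √2 + 1) (by linarith) (by linarith) (by linarith)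
    (fun z hz x hx => phiLune_real_lt hz hx) (fun p hp hp0 h => subordinate_phiLune hp hp0 h) ?_ ?_
  · rw [hi, primitiveReal_one]
    linear_combination -(√2 - Real.log (1 + √2) + Real.log 2 - 1) * hs2
  · rw [hi', primitiveReal_neg_one]
    -- A crude lower bound for G(1)/2 suffices: the left-end condition holds with room to spare.
    have h1 : 0.2 ≤ √2 - Real.log (1 + √2) + Real.log 2 - 1 := by linarith
    have h2 : 3.4 * 0.2 ≤ (2 + √2) * (√2 - Real.log (1 + √2) + Real.log 2 - 1) := by
      gcongr; linarith
    nlinarith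

/-! ### The sine -/

/-- The principal branch of the inverse sine. -/
noncomputable def arcsin (u : ℂ) : ℂ :=
  -Complex.I * Complex.log (Complex.I * u + Complex.sqrt (1 - u ^ 2))

theorem one_sub_sq_re_pos {u : ℂ} (hu : ‖u‖ < 1) : 0 < (1 - u ^ 2).re := by
  have h1 := Complex.re_le_norm (u ^ 2)
  rw [norm_pow] at h1
  rw [Complex.sub_re, Complex.one_re]
  nlinarith [norm_nonneg u]

/-- If e = iu + s with s² = 1 - u², then e⁻¹ = s - iu, so Re e + Re e⁻¹ = 2 Re s > 0; and Re e⁻¹ has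
the sign of Re e. -/
theorem I_mul_add_sqrt_re_pos {u : ℂ} (hu : ‖u‖ < 1) :
    0 < (Complex.I * u + Complex.sqrt (1 - u ^ 2)).re := by
  have hs := sqrt_re_pos (one_sub_sq_re_pos hu)
  have hs2 := sqrt_sq (1 - u ^ 2)
  set s := Complex.sqrt (1 - u ^ 2)
  set e := Complex.I * u + s with he
  have h1 : e * (s - Complex.I * u) = 1 := by
    rw [he]; linear_combination hs2 - u ^ 2 * Complex.I_sq
  have h2 : e⁻¹ = s - Complex.I * u := inv_eq_of_mul_eq_one_right h1
  have h3 : (e + e⁻¹).re = 2 * s.re := by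
    rw [h2, he, show Complex.I * u + s + (s - Complex.I * u) = s + s by ring, Complex.add_re]; ring
  rw [Complex.add_re, Complex.inv_re] at h3
  by_contra! hle
  have : e.re / Complex.normSq e ≤ 0 := div_nonpos_of_nonpos_of_nonneg hle (Complex.normSq_nonneg _)
  linarith

theorem analyticAt_arcsin {u : ℂ} (hu : ‖u‖ < 1) : AnalyticAt ℂ arcsin u := by
  have h1 : AnalyticAt ℂ (fun u : ℂ => Complex.sqrt (1 - u ^ 2)) u :=
    AnalyticAt.fun_comp (f := fun u : ℂ => 1 - u ^ 2)
      (analyticAt_sqrt (Or.inl (one_sub_sq_re_pos hu))) (analyticAt_const.sub (analyticAt_id.pow 2))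
  exact analyticAt_const.mul (((analyticAt_const.mul analyticAt_id).add h1).clog
    (Or.inl (I_mul_add_sqrt_re_pos hu)))

theorem sin_arcsin {u : ℂ} (hu : ‖u‖ < 1) : Complex.sin (arcsin u) = u := by
  have hs2 := sqrt_sq (1 - u ^ 2)
  have hpos := I_mul_add_sqrt_re_pos hu
  set s := Complex.sqrt (1 - u ^ 2) with hs
  have he : Complex.I * u + s ≠ 0 := by
    intro h0; simp [h0] at hpos
  have h1 : (Complex.I * u + s) * (s - Complex.I * u) = 1 := by
    linear_combination hs2 - u ^ 2 * Complex.I_sq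
  have h2 : (Complex.I * u + s)⁻¹ = s - Complex.I * u := inv_eq_of_mul_eq_one_right h1
  have e1 : arcsin u * Complex.I = Complex.log (Complex.I * u + s) := by
    rw [arcsin, ← hs]
    linear_combination -Complex.log (Complex.I * u + s) * Complex.I_sq
  rw [Complex.sin, neg_mul, e1, Complex.exp_neg, Complex.exp_log he, h2]
  linear_combination -u * Complex.I_sq

theorem abs_arcsin_re_le {u : ℂ} (hu : ‖u‖ < 1) : |(arcsin u).re| ≤ Real.pi / 2 := by
  have e : (arcsin u).re = (Complex.I * u + Complex.sqrt (1 - u ^ 2)).arg := by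
    rw [arcsin]
    simp [Complex.log_im]
  rw [e]
  exact Complex.abs_arg_le_pi_div_two_iff.2 (I_mul_add_sqrt_re_pos hu).le

theorem normSq_sin (z : ℂ) :
    Complex.normSq (Complex.sin z) = Real.sin z.re ^ 2 + Real.sinh z.im ^ 2 := by
  have h1 := Real.cosh_sq z.im
  have h2 := Real.sin_sq_add_cos_sq z.re
  rw [Complex.sin_eq, ← Complex.ofReal_sin, ← Complex.ofReal_cos, ← Complex.ofReal_sinh,
    ← Complex.ofReal_cosh, ← Complex.ofReal_mul, ← Complex.ofReal_mul, Complex.normSq_add_mul_I]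
  rw [mul_pow, mul_pow, h1]
  linear_combination Real.sinh z.im ^ 2 * h2

/-- Outside the unit disk, and in the strip where the sine is injective, the modulus of the sine is
at least `sin 1`. -/
theorem sin_one_le_norm_sin {z : ℂ} (hz : 1 ≤ ‖z‖) (hre : |z.re| ≤ Real.pi / 2) :
    Real.sin 1 ≤ ‖Complex.sin z‖ := by
  have hs1 : 0 < Real.sin 1 := Real.sin_pos_of_pos_of_lt_pi one_pos (by linarith [Real.pi_gt_three])
  refine abs_le_of_sq_le_sq' ?_ (norm_nonneg _) |>.2
  rw [← Complex.normSq_eq_norm_sq, normSq_sin]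
  have hz2 : 1 ≤ z.re ^ 2 + z.im ^ 2 := by
    have : 1 ≤ ‖z‖ ^ 2 := one_le_pow₀ hz
    rw [← Complex.normSq_eq_norm_sq, Complex.normSq_apply] at this
    nlinarith
  have hsin : Real.sin z.re ^ 2 = Real.sin |z.re| ^ 2 := by
    rcases abs_cases z.re with ⟨h, -⟩ | ⟨h, -⟩ <;> simp [h]
  have hre2 : z.re ^ 2 = |z.re| ^ 2 := (sq_abs _).symm
  rw [hsin]
  rw [hre2] at hz2
  have hx0 := abs_nonneg z.re
  generalize |z.re| = x at *
  rcases le_total 1 x with h | h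
  · have : Real.sin 1 ≤ Real.sin x := Real.sin_le_sin_of_le_of_le_pi_div_two
      (by linarith [Real.pi_pos]) hre h
    nlinarith [sq_nonneg (Real.sinh z.im)]
  -- Here sinh² y ≥ y² ≥ 1 - x², so it remains to see x² - sin² x ≤ 1 - sin² 1: both factors x ∓ sin
  -- x are no larger than at 1.
  · have hsinh : z.im ^ 2 ≤ Real.sinh z.im ^ 2 := by
      rw [← sq_abs z.im, ← sq_abs (Real.sinh z.im), Real.abs_sinh]
      have := Real.self_le_sinh_iff.2 (abs_nonneg z.im)
      gcongr
    have h1 : Real.sin x ≤ Real.sin 1 := Real.sin_le_sin_of_le_of_le_pi_div_two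
      (by linarith [Real.pi_pos]) (by linarith [Real.pi_gt_three]) h
    have h2 : Real.sin 1 - Real.sin x ≤ 1 - x := by
      have := Real.abs_sin_sub_sin_le 1 x
      rw [abs_of_nonneg (by linarith), abs_of_nonneg (by linarith)] at this
      exact this
    have h3 : 0 ≤ Real.sin x := Real.sin_nonneg_of_nonneg_of_le_pi hx0 (by
      linarith [Real.pi_gt_three])
    nlinarith [mul_nonneg (by linarith : 0 ≤ 1 - x - (Real.sin 1 - Real.sin x))
      (by linarith : 0 ≤ 1 + Real.sin 1), mul_nonneg
      (by linarith [Real.sin_le hx0] : 0 ≤ x - Real.sin x)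
      (by linarith : 0 ≤ 1 + Real.sin 1 - (x + Real.sin x))]

theorem sin_one_bounds : 0.75 < Real.sin 1 ∧ Real.sin 1 < 1 := by
  constructor
  · have := Real.sin_gt_sub_cube one_pos
    norm_num at this ⊢
    linarith
  · exact Real.sin_lt one_pos

theorem subordinate_phiSin {p : ℂ → ℂ} (hp : AnalyticOnNhd ℂ p unitDisk) (hp0 : p 0 = 1)
    (h : ∀ z ∈ unitDisk, InDisk (1 - Real.sin 1) (1 + Real.sin 1) (p z)) :
    Subordinate p phiSin := by
  have hs := sin_one_bounds
  have hlt : ∀ z ∈ unitDisk, ‖p z - 1‖ < Real.sin 1 := by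
    intro z hz
    have h1 := h z hz
    rw [InDisk] at h1
    refine lt_of_pow_lt_pow_left₀ 2 (by linarith) ?_
    rw [← Complex.normSq_eq_norm_sq, Complex.normSq_apply]
    simp only [Complex.sub_re, Complex.sub_im, Complex.one_re, Complex.one_im]
    nlinarith
  refine ⟨fun z => arcsin (p z - 1), fun z hz => ?_, fun z hz => ?_, ?_, fun z hz => ?_⟩
  · exact AnalyticAt.fun_comp (f := fun z => p z - 1) (analyticAt_arcsin ((hlt z hz).trans hs.2))
      ((hp z hz).sub analyticAt_const)
  · rw [mem_unitDisk]
    by_contra! hle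
    have h1 := (hlt z hz).trans hs.2
    have := sin_one_le_norm_sin hle (abs_arcsin_re_le h1)
    rw [sin_arcsin h1] at this
    exact absurd (hlt z hz) (not_lt.2 this)
  · simp [hp0, arcsin]
  · rw [phiSin, sin_arcsin ((hlt z hz).trans hs.2)]
    ring

/-- On 𝔻, cos(Re z) > 0, so a real value of the sine forces sinh(Im z) = 0. -/
theorem phiSin_real_lt {z : ℂ} (hz : z ∈ unitDisk) {x : ℝ} (hx : phiSin z = x) :
    x < 1 + Real.sin 1 := by
  have hz1 := mem_unitDisk.1 hz
  have hre := abs_lt.1 ((Complex.abs_re_le_norm z).trans_lt hz1)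
  have e : Complex.sin z = ((x - 1 : ℝ) : ℂ) := by
    rw [Complex.ofReal_sub, ← hx, phiSin, Complex.ofReal_one]; ring
  rw [Complex.sin_eq, ← Complex.ofReal_sin, ← Complex.ofReal_cos, ← Complex.ofReal_sinh,
    ← Complex.ofReal_cosh, ← Complex.ofReal_mul, ← Complex.ofReal_mul] at e
  have e1 := congrArg Complex.re e
  have e2 := congrArg Complex.im e
  simp only [Complex.add_re, Complex.add_im, Complex.re_ofReal_mul, Complex.im_ofReal_mul,
    Complex.ofReal_re, Complex.ofReal_im, Complex.I_re, Complex.I_im, mul_zero, mul_one, add_zero,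
    zero_add] at e1 e2
  have hcos : 0 < Real.cos z.re := Real.cos_pos_of_mem_Ioo
    ⟨by linarith [Real.pi_gt_three], by linarith [Real.pi_gt_three]⟩
  have him : z.im = 0 := Real.sinh_eq_zero.1 ((mul_eq_zero.1 e2).resolve_left hcos.ne')
  rw [him, Real.cosh_zero, mul_one] at e1
  have : Real.sin z.re < Real.sin 1 := Real.sin_lt_sin_of_lt_of_le_pi_div_two
    (by linarith [Real.pi_gt_three]) (by linarith [Real.pi_gt_three]) hre.2
  linarith

theorem isSharpBound_phiSin : IsSharpBound phiSin
    (2 * (1 + Real.sin 1) * (√2 - Real.log (1 + √2) + Real.log 2 - 1) / Real.sin 1) := by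
  have hs := sqrt_two_bounds
  have hl := log_one_add_sqrt_two_bounds
  have hl2 := Real.log_two_gt_d9
  have hsin := sin_one_bounds
  have h0 : 0 < Real.sin 1 := by linarith
  have h1 : 0 < 1 - Real.sin 1 := by linarith
  refine isSharpBound_of_top (a := 1 - Real.sin 1) (b := 1 + Real.sin 1) h1
    (by linarith) (by linarith) (fun z hz x hx => phiSin_real_lt hz hx)
    (fun p hp hp0 h => subordinate_phiSin hp hp0 h) ?_ ?_
  · rw [primitiveReal_one]
    field_simp
    ring
  · have e : 2 * (1 + Real.sin 1) * (√2 - Real.log (1 + √2) + Real.log 2 - 1) / Real.sin 1 *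
        ((1 - Real.sin 1)⁻¹ - 1) =
        2 * (1 + Real.sin 1) * (√2 - Real.log (1 + √2) + Real.log 2 - 1) / (1 - Real.sin 1) := by
      field_simp
      ring
    rw [e, primitiveReal_neg_one, le_div_iff₀ h1]
    have h2 : 0.2 ≤ √2 - Real.log (1 + √2) + Real.log 2 - 1 := by linarith
    nlinarith

/-! ### The rational function -/

theorem kConst_sq : kConst ^ 2 = 2 * kConst + 1 := by
  have hs2 : √2 ^ 2 = 2 := Real.sq_sqrt (by norm_num)
  rw [kConst]
  linear_combination hs2

theorem kConst_bounds : 2.414 < kConst ∧ kConst < 2.4143 := by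
  have hs := sqrt_two_bounds
  rw [kConst]
  constructor <;> linarith

/-- Since φ₀(ζ) - (2k - 4) = (1 + ζ)²/(k(k - ζ)), the reciprocal is quadratic in 1/(1 + ζ).
Completing the square with (k + 1)/k = k - 1 gives T = S², where S = 2(k + 1)/(1 + ζ) - 1. Thus ζ is
recovered from S, and |ζ| < 1 means Re S > k. -/
theorem subordinate_phiZero {p : ℂ → ℂ} (hp : AnalyticOnNhd ℂ p unitDisk) (hp0 : p 0 = 1)
    (h : ∀ z ∈ unitDisk, InDisk (2 * kConst - 4) 2 (p z)) : Subordinate p phiZero := by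
  have hk2 := kConst_sq
  have hk := kConst_bounds
  have hk2' : (kConst : ℂ) ^ 2 = 2 * kConst + 1 := by exact_mod_cast hk2
  set k := kConst with hkdef
  have hk0 : (k : ℂ) ≠ 0 := by
    exact_mod_cast (by linarith : (0 : ℝ) < k).ne'
  have hk1 : (k : ℂ) + 1 ≠ 0 := by
    exact_mod_cast (by linarith : (0 : ℝ) < k + 1).ne'
  set d : ℂ → ℂ := fun z => p z - (2 * k - 4 : ℝ) with hd
  have hd0 : ∀ z ∈ unitDisk, d z ≠ 0 := fun z hz h0 => by
    have h1 := ((h z hz).re_mem (by linarith)).1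
    have h2 := congrArg Complex.re (sub_eq_zero.1 h0)
    rw [Complex.ofReal_re] at h2
    linarith
  set T : ℂ → ℂ := fun z => 1 + 4 * ((k - 1 : ℝ) : ℂ) * (d z)⁻¹ with hT
  -- Inversion sends the disk on [0, 6 - 2k] to a half-plane; (6 - 2k)(k + 1) = 4 makes its edge k².
  -- As Re S² ≤ (Re S)², this yields Re S > k.
  have hTre : ∀ z ∈ unitDisk, k ^ 2 < (T z).re := by
    intro z hz
    have h1 := h z hz
    have hn := Complex.normSq_pos.2 (hd0 z hz)
    have e : (T z).re = 1 + 4 * (k - 1) * ((d z).re / Complex.normSq (d z)) := by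
      simp only [hT]
      rw [Complex.add_re, Complex.one_re, show (4 : ℂ) * ((k - 1 : ℝ) : ℂ) =
        ((4 * (k - 1) : ℝ) : ℂ) by push_cast; ring, Complex.re_ofReal_mul, Complex.inv_re]
    have h2 : Complex.normSq (d z) < (6 - 2 * k) * (d z).re := by
      rw [InDisk] at h1
      rw [Complex.normSq_apply]
      simp only [hd, Complex.sub_re, Complex.sub_im, Complex.ofReal_re, Complex.ofReal_im]
      nlinarith
    have h3 : 1 / (6 - 2 * k) < (d z).re / Complex.normSq (d z) := by
      rw [div_lt_div_iff₀ (by linarith) hn]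
      linarith
    have h4 : 1 / (6 - 2 * k) = (k + 1) / 4 := by
      rw [div_eq_div_iff (by linarith) (by norm_num)]
      linear_combination 2 * hk2
    rw [h4] at h3
    rw [e]
    nlinarith
  set S : ℂ → ℂ := fun z => Complex.sqrt (T z) with hS
  have hS2 : ∀ z, S z ^ 2 = T z := fun z => sqrt_sq _
  have hSre : ∀ z ∈ unitDisk, k < (S z).re := by
    intro z hz
    have h1 := hTre z hz
    have h2 : 0 ≤ (S z).re := sqrt_re_nonneg _
    rw [← hS2, pow_two (S z), Complex.mul_re] at h1
    nlinarith [mul_self_nonneg (S z).im]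
  have hSne : ∀ z ∈ unitDisk, ∀ c : ℝ, c < k → S z - c ≠ 0 := by
    intro z hz c hc h0
    have := hSre z hz
    rw [sub_eq_zero.1 h0, Complex.ofReal_re] at this
    linarith
  have hS1 : ∀ z ∈ unitDisk, 1 + S z ≠ 0 := fun z hz => by
    have := hSne z hz (-1) (by linarith)
    rwa [Complex.ofReal_neg, Complex.ofReal_one, sub_neg_eq_add, add_comm] at this
  refine ⟨fun z => -1 + 2 * (k + 1) / (1 + S z), fun z hz => ?_, fun z hz => ?_, ?_, fun z hz => ?_⟩
  · have hda : AnalyticAt ℂ d z := (hp z hz).sub analyticAt_const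
    have hTa : AnalyticAt ℂ T z :=
      analyticAt_const.add (analyticAt_const.mul (hda.inv (hd0 z hz)))
    have hSa : AnalyticAt ℂ S z :=
      (analyticAt_sqrt (Or.inl ((sq_nonneg k).trans_lt (hTre z hz)))).fun_comp hTa
    exact analyticAt_const.add (analyticAt_const.div (analyticAt_const.add hSa) (hS1 z hz))
  · have e : -1 + 2 * (k + 1) / (1 + S z) = (2 * (k + 1) - (1 + S z)) / (1 + S z) := by
      have := hS1 z hz
      field_simp
      ring
    have hr := hSre z hz
    rw [mem_unitDisk]
    change ‖-1 + 2 * (k + 1) / (1 + S z)‖ < 1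
    rw [e, norm_div, div_lt_one (norm_pos_iff.2 (hS1 z hz)),
      ← sq_lt_sq₀ (norm_nonneg _) (norm_nonneg _), ← Complex.normSq_eq_norm_sq,
      ← Complex.normSq_eq_norm_sq, Complex.normSq_apply, Complex.normSq_apply,
      show (2 : ℂ) * (k + 1) = ((2 * (k + 1) : ℝ) : ℂ) by push_cast; ring]
    simp only [Complex.sub_re, Complex.sub_im, Complex.add_re, Complex.add_im, Complex.ofReal_re,
      Complex.ofReal_im, Complex.one_re, Complex.one_im]
    nlinarith
  · have hd00 : d 0 = 5 - 2 * k := by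
      simp only [hd, hp0]; push_cast; ring
    have hinv : (d 0)⁻¹ = (k : ℂ) ^ 2 := by
      refine inv_eq_of_mul_eq_one_right ?_
      rw [hd00]
      linear_combination (1 - 2 * k : ℂ) * hk2'
    have hS0 : S 0 = (k ^ 2 : ℝ) := by
      refine sqrt_eq_of_sq_eq ?_ ?_
      · simp only [hT, hinv]
        push_cast
        linear_combination ((k : ℂ) ^ 2 - 2 * k + 1) * hk2'
      · rw [Complex.ofReal_re]; nlinarith
    simp only [hS0]
    push_cast
    rw [hk2', show (1 : ℂ) + (2 * k + 1) = 2 * (k + 1) by ring,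
      div_self (mul_ne_zero two_ne_zero hk1)]
    ring
  · have hs1 := hS1 z hz
    have hs2 : S z - 1 ≠ 0 := by
      have := hSne z hz 1 (by linarith)
      rwa [Complex.ofReal_one] at this
    have hdz := hd0 z hz
    have e1 : (S z ^ 2 - 1) * d z = 4 * (k - 1) := by
      rw [hS2]
      simp only [hT]
      push_cast
      field_simp
      ring
    have e2 : d z = 4 * (k - 1) / ((S z - 1) * (1 + S z)) := by
      rw [eq_div_iff (mul_ne_zero hs2 hs1)]
      linear_combination e1
    have e3 : p z = 2 * k - 4 + 4 * (k - 1) / ((S z - 1) * (1 + S z)) := by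
      rw [← e2]
      simp only [hd]; push_cast; ring
    have e4 : (k : ℂ) - (-1 + 2 * (k + 1) / (1 + S z)) = (k + 1) * (S z - 1) / (1 + S z) := by
      field_simp; ring
    change p z = phiZero (-1 + 2 * (k + 1) / (1 + S z))
    rw [phiZero, ← hkdef, e4, e3]
    generalize S z = s at *
    field_simp
    linear_combination (2 * (1 + s ^ 2) * k + (1 - s) ^ 2) * hk2'

theorem phiZero_real_mem {z : ℂ} (hz : z ∈ unitDisk) {x : ℝ} (hx : phiZero z = x) :
    2 * kConst - 4 < x ∧ x < 2 := by
  have hk2 := kConst_sq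
  have hk := kConst_bounds
  rw [phiZero] at hx
  generalize kConst = k at *
  have hz1 := mem_unitDisk.1 hz
  have hre := abs_lt.1 ((Complex.abs_re_le_norm z).trans_lt hz1)
  have hk0 : (k : ℂ) ≠ 0 := by
    exact_mod_cast (by linarith : (0 : ℝ) < k).ne'
  have hkz : (k : ℂ) - z ≠ 0 := by
    intro h0
    have := congrArg Complex.re (sub_eq_zero.1 h0)
    rw [Complex.ofReal_re] at this
    linarith
  have e : z ^ 2 + k * x * z - k ^ 2 * (x - 1) = 0 := by
    rw [← hx]
    field_simp
    ring
  have hn : z.re ^ 2 + z.im ^ 2 < 1 := by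
    have : ‖z‖ ^ 2 < 1 := by nlinarith [norm_nonneg z]
    rw [← Complex.normSq_eq_norm_sq, Complex.normSq_apply] at this
    nlinarith
  have e1 := congrArg Complex.re e
  have e2 := congrArg Complex.im e
  rw [show z ^ 2 + k * x * z - k ^ 2 * (x - 1) =
    z * z + ((k * x : ℝ) : ℂ) * z - ((k ^ 2 * (x - 1) : ℝ) : ℂ) by push_cast; ring] at e1 e2
  simp only [Complex.sub_re, Complex.sub_im, Complex.add_re, Complex.add_im, Complex.mul_re,
    Complex.mul_im, Complex.ofReal_re, Complex.ofReal_im, Complex.zero_re, Complex.zero_im,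
    zero_mul, sub_zero, add_zero] at e1 e2
  generalize z.re = r at *
  generalize z.im = y at *
  -- The equation φ₀(z) = x is a real quadratic in z. A nonreal z has its conjugate as the other
  -- root, so k²(1 - x) = |z|² lies in (0, 1), and 1 - 1/k² = 2k - 4.
  rcases eq_or_ne y 0 with rfl | hy
  · have hx' : x * (k * (k - r)) = k ^ 2 - k * r + r * (k + r) := by linear_combination -e1
    have hpos : 0 < k * (k - r) := mul_pos (by linarith) (by linarith)
    constructor
    · have : 0 < (x - (2 * k - 4)) * (k * (k - r)) := by
        have : (x - (2 * k - 4)) * (k * (k - r)) = (1 + r) ^ 2 := by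
          linear_combination hx' + (1 - 2 * k + 2 * r) * hk2
        rw [this]
        have : 0 < 1 + r := by linarith
        positivity
      have := pos_of_mul_pos_left this hpos.le
      linarith
    · have : 0 < (2 - x) * (k * (k - r)) := by
        have : (2 - x) * (k * (k - r)) = 2 * k * (1 - r) + (1 - r ^ 2) := by
          linear_combination -hx' + hk2
        rw [this]
        have : 0 < 2 * k * (1 - r) := mul_pos (by linarith) (by linarith)
        nlinarith
      have := pos_of_mul_pos_left this hpos.le
      linarith
  · have h1 : 2 * r = -(k * x) := by
      have : y * (2 * r + k * x) = 0 := by linear_combination e2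
      have := (mul_eq_zero.1 this).resolve_left hy
      linarith
    have h2 : k ^ 2 * (1 - x) = r ^ 2 + y ^ 2 := by
      linear_combination e1 - r * h1
    constructor
    · by_contra! hle
      have h3 : k ^ 2 * (5 - 2 * k) = 1 := by linear_combination (1 - 2 * k) * hk2
      nlinarith [mul_nonneg (sq_nonneg k) (by linarith : 0 ≤ 2 * k - 4 - x)]
    · by_contra! hle
      nlinarith [mul_pos (by linarith : 0 < k) (by linarith : 0 < k), sq_nonneg r, sq_nonneg y]

theorem isSharpBound_phiZero : IsSharpBound phiZero (4 * (1 + √2) * (1 - Real.log 2)) := by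
  have hk2 := kConst_sq
  have hk := kConst_bounds
  have hs := sqrt_two_bounds
  have hl := log_one_add_sqrt_two_bounds
  have hl2 := Real.log_two_lt_d9
  have hi : (2 * kConst - 4)⁻¹ = kConst / 2 := by
    refine inv_eq_of_mul_eq_one_right ?_
    linear_combination hk2
  refine isSharpBound_of_bot (a := 2 * kConst - 4) (b := 2) (by linarith) (by linarith)
    (by norm_num) (fun z hz x hx => phiZero_real_mem hz hx)
    (fun p hp hp0 h => subordinate_phiZero hp hp0 h) ?_ ?_
  · rw [hi, primitiveReal_neg_one, show √2 = kConst - 1 by rw [kConst]; ring]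
    linear_combination 2 * (1 - Real.log 2) * hk2
  -- The right end is far from critical: log 2 ≤ log(1 + √2) already gives G(1) ≤ 2(√2 - 1).
  · rw [primitiveReal_one]
    nlinarith

end LemniscateSubordination

theorem theorem2p4 :
    LemniscateSubordination.IsSharpBound LemniscateSubordination.phiZero
      (4 * (1 + Real.sqrt 2) * (1 - Real.log 2)) ∧
    LemniscateSubordination.IsSharpBound LemniscateSubordination.phiSin
      (2 * (1 + Real.sin 1) * (Real.sqrt 2 - Real.log (1 + Real.sqrt 2) + Real.log 2 - 1) /
        Real.sin 1) ∧
    LemniscateSubordination.IsSharpBound LemniscateSubordination.phiLune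
      ((2 + Real.sqrt 2) * (Real.sqrt 2 - Real.log (1 + Real.sqrt 2) + Real.log 2 - 1)) ∧
    ∀ A B : ℝ, -1 < B → B < A → A < 1 →
      (A < LemniscateSubordination.thresholdA →
        LemniscateSubordination.IsSharpBound (LemniscateSubordination.janowski A B)
          (2 * (1 - A) * (1 - Real.log 2) / (A - B))) ∧
      (LemniscateSubordination.thresholdA < A →
        LemniscateSubordination.IsSharpBound (LemniscateSubordination.janowski A B)
          (2 * (1 + A) * (Real.sqrt 2 - 1 + Real.log 2 - Real.log (1 + Real.sqrt 2)) /
            (A - B))) := ⟨LemniscateSubordination.isSharpBound_phiZero, LemniscateSubordination.isSharpBound_phiSin,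
    LemniscateSubordination.isSharpBound_phiLune, fun _ _ hB hAB hA =>
    ⟨LemniscateSubordination.isSharpBound_janowski_of_lt hB hAB hA,
      LemniscateSubordination.isSharpBound_janowski_of_gt hB hAB hA⟩⟩
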